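/- Let $a\le 0$, $\sigma>0$, $h>0$, let $M,N\ge 1$ be integers, and put $T=Nh$ and $B=MN$. On a probability space let $x_1,\dots,x_M$ be independent processes with continuous paths, each solving the scalar Langevin equation $dx_i(t)=a\,x_i(t)\,dt+\sigma\,dw_i(t)$, $x_i(0)=0$, where $w_i$ is a standard Wiener process. Let $$V_T=\mathbb E\Big[\int_0^T x_i(t)^2\,dt\Big],\qquad \hat V_M(h)=\frac1M\sum_{i=1}^M\sum_{k=0}^{N-1}h\,x_i(kh)^2,\qquad \mathrm{MSE}_T(h,B)=\mathbb E\big[(\hat V_M(h)-V_T)^2\big]$$ ($V_T$ does not depend on $i$). Then these expectations are finite and $$\mathrm{MSE}_T(h,B)=E_1(h,T,a)+\frac{E_2(h,T,a)}{B},$$ where, for $a\neq 0$, $$E_1(h,T,a)=\frac{\sigma^4\left(-2ah+e^{2ah}-1\right)^2\left(e^{2aT}-1\right)^2}{16a^4\left(e^{2ah}-1\right)^2},$$ $$E_2(h,T,a)=\frac{\sigma^4T\left[h\left(e^{2aT}-1\right)\left(4e^{2ah}+e^{2aT}+1\right)-\left(e^{2ah}-1\right)\left(e^{2ah}+4e^{2aT}+1\right)T\right]}{2a^2\left(e^{2ah}-1\right)^2},$$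 and, for $a=0$, $E_1$ and $E_2$ are read as the limits of these expressions as $a\to0$, namely $$E_1(h,T,0)=\frac{\sigma^4T^2h^2}{4},\qquad E_2(h,T,0)=\frac{\sigma^4T^5}{3h}+\frac{\sigma^4T^2\left(-2T^2+2hT-h^2\right)}{3}.$$ -/

import Mathlib

open MeasureTheory ProbabilityTheory Filter Topology
open scoped NNReal

noncomputable section

namespace LangevinMC

variable {Ω : Type*} [MeasurableSpace Ω]

/-- `x` solves `dx = a x dt + σ dw`, `x(0) = 0`, on `[0, ∞)`, where `w` is a standard Wiener
process under `μ`: the paths of `x` are almost surely continuous and satisfy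
`x(t) = a ∫₀ᵗ x(s) ds + σ w(t)` for all `t ≥ 0`. As the noise is additive, the stochastic
integral of the constant `σ` is `σ w(t)`. -/
structure IsLangevinSolution (μ : Measure Ω) (a σ : ℝ) (w x : ℝ≥0 → Ω → ℝ) : Prop where
  wiener : IsBrownianReal w μ
  cont : ∀ᵐ ω ∂μ, Continuous fun t : ℝ≥0 => x t ω
  init : ∀ᵐ ω ∂μ, x 0 ω = 0
  eqn : ∀ᵐ ω ∂μ, ∀ t : ℝ≥0,
    x t ω = a * (∫ s in (0 : ℝ)..t, x s.toNNReal ω) + σ * w t ω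

/-- The undiscounted quadratic cost `∫₀ᵀ x(t)² dt` of one trajectory. -/
def cost (x : ℝ≥0 → Ω → ℝ) (T : ℝ) (ω : Ω) : ℝ :=
  ∫ t in (0 : ℝ)..T, x t.toNNReal ω ^ 2

/-- The expected cost `V_T`. -/
def expectedCost (μ : Measure Ω) (x : ℝ≥0 → Ω → ℝ) (T : ℝ) : ℝ :=
  ∫ ω, cost x T ω ∂μ

/-- The Riemann sum `∑_{k=0}^{N-1} h x(kh)²` of one trajectory. -/
def riemannSum (x : ℝ≥0 → Ω → ℝ) (h : ℝ) (N : ℕ) (ω : Ω) : ℝ :=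
  ∑ k ∈ Finset.range N, h * x (k * h).toNNReal ω ^ 2

/-- The Monte-Carlo estimator: the average of the Riemann sums of `M` trajectories. -/
def mcEstimator {M : ℕ} (x : Fin M → ℝ≥0 → Ω → ℝ) (h : ℝ) (N : ℕ) (ω : Ω) : ℝ :=
  (1 / (M : ℝ)) * ∑ i, riemannSum (x i) h N ω

/-- The mean-squared error `𝔼[(Vhat - V)²]` of the Monte-Carlo estimator as an estimate of `V`. -/
def mse {M : ℕ} (μ : Measure Ω) (x : Fin M → ℝ≥0 → Ω → ℝ) (h : ℝ) (N : ℕ) (V : ℝ) : ℝ :=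
  ∫ ω, (mcEstimator x h N ω - V) ^ 2 ∂μ

/-- The squared-bias term, for `a ≠ 0`. -/
def E₁ (σ h T a : ℝ) : ℝ :=
  σ ^ 4 * (-2 * a * h + Real.exp (2 * a * h) - 1) ^ 2 * (Real.exp (2 * a * T) - 1) ^ 2 /
    (16 * a ^ 4 * (Real.exp (2 * a * h) - 1) ^ 2)

/-- The variance term, for `a ≠ 0`. -/
def E₂ (σ h T a : ℝ) : ℝ :=
  σ ^ 4 * T *
      (h * (Real.exp (2 * a * T) - 1) * (4 * Real.exp (2 * a * h) + Real.exp (2 * a * T) + 1) -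
        (Real.exp (2 * a * h) - 1) * (Real.exp (2 * a * h) + 4 * Real.exp (2 * a * T) + 1) * T) /
    (2 * a ^ 2 * (Real.exp (2 * a * h) - 1) ^ 2)

end LangevinMC

end

/-!
The solution is the Gaussian process given by variation of constants,
`x t = σ (w t + a ∫₀ᵗ exp (a (t - s)) w s ds)`, for almost every path (`variation_of_constants`).
Each `x t` is an almost sure limit of linear combinations of values of `w`, and so are all linear
combinations of the `x t` (`limitSpan`); such limits are centred Gaussian
(`IsCenteredGaussian.of_tendsto`). Testing the formula against `w r` and then against `x s`, with
Fubini's theorem on a jointly measurable version of the process, gives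
`𝔼[x s x t] = σ² exp (a (t - s)) φ(s)` for `s ≤ t`, where `φ(s) = ∫₀ˢ exp (2 a r) dr` is
`unitVariance a s` (`IsRegularLangevin.integral_mul`). Isserlis' formula, obtained by polarization
from the fourth moment of a real Gaussian, then gives
`Cov (x s ², x t ²) = 2 𝔼[x s x t]²` (`IsCenteredGaussian.covariance_sq_sq`).

Consequently the Riemann sum of one trajectory has an explicit bias `bias σ h N a` and variance
`riemannVariance σ h N a`, and independence of the trajectories gives
`mse = bias² + riemannVariance / M` for every `a ≤ 0` (`mse_eq_bias_sq_add`). For `a ≠ 0`, writing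
`q = exp (2 a h)`, the finite sums are geometric sums in `q` and evaluate to `E₁ = bias²` and
`E₂ = N * riemannVariance`. Both `bias` and `riemannVariance` are continuous in the drift `a`, so
the limits of `E₁` and `E₂` at `0` are their values at `0`, which are sums of powers; the case
`a = 0` needs no Taylor expansion of the closed forms.
-/

noncomputable section

namespace LangevinMC

section

variable {Ω : Type*} [MeasurableSpace Ω]

/-! ### Centred Gaussian variables -/

theorem integral_pow_four_gaussianReal (v : ℝ≥0) :
    ∫ x, x ^ 4 ∂(gaussianReal 0 v) = 3 * (v : ℝ) ^ 2 := by
  have h := iteratedDeriv_mgf_zero (X := fun x : ℝ => x) (μ := gaussianReal 0 v) (by simp) 4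
  rw [mgf_fun_id_gaussianReal] at h
  -- Differentiating `p(t) exp (v t² / 2)` acts on `p` as `p ↦ p' + v t p`.
  have hd (p : Polynomial ℝ) :
      deriv (fun t : ℝ => p.eval t * Real.exp (0 * t + v * t ^ 2 / 2)) =
        fun t => (p.derivative + p * (Polynomial.C (v : ℝ) * Polynomial.X)).eval t *
          Real.exp (0 * t + v * t ^ 2 / 2) := by
    funext t
    have h2 : HasDerivAt (fun t : ℝ => 0 * t + v * t ^ 2 / 2) (v * t) t := by
      have h3 : HasDerivAt (fun t : ℝ => 0 * t + v * t ^ 2 / 2)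
          (0 * 1 + v * ((2 : ℕ) * t ^ (2 - 1)) / 2) t :=
        ((hasDerivAt_id t).const_mul 0).add (((hasDerivAt_pow 2 t).const_mul (v : ℝ)).div_const 2)
      refine h3.congr_deriv ?_
      push_cast
      ring
    have h4 : HasDerivAt (fun t : ℝ => p.eval t * Real.exp (0 * t + v * t ^ 2 / 2)) _ t :=
      (p.hasDerivAt t).mul h2.exp
    rw [h4.deriv]
    simp
    ring
  have e1 : (fun t : ℝ => Real.exp (0 * t + v * t ^ 2 / 2)) =
      fun t => (1 : Polynomial ℝ).eval t * Real.exp (0 * t + v * t ^ 2 / 2) := by simp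
  rw [e1, iteratedDeriv_succ', hd, iteratedDeriv_succ', hd, iteratedDeriv_succ', hd,
    iteratedDeriv_succ', hd, iteratedDeriv_zero] at h
  simp at h
  rw [← h]
  ring

/-- A random variable with a (possibly degenerate) centred Gaussian law. -/
def IsCenteredGaussian (μ : Measure Ω) (X : Ω → ℝ) : Prop :=
  ∃ v : ℝ≥0, HasLaw X (gaussianReal 0 v) μ

namespace IsCenteredGaussian

variable {μ : Measure Ω} {X Y : Ω → ℝ}

theorem memLp (hX : IsCenteredGaussian μ X) {p : ENNReal} (hp : p ≠ ⊤) : MemLp X p μ := by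
  obtain ⟨v, hv⟩ := hX
  exact hv.hasGaussianLaw.memLp hp

theorem memLp_sq (hX : IsCenteredGaussian μ X) : MemLp (fun ω => X ω ^ 2) 2 μ := by
  have h : MemLp X 4 μ := hX.memLp (by simp)
  have : ENNReal.HolderTriple 4 4 2 := ⟨by
    rw [← two_mul, show (4 : ENNReal) = 2 * 2 by norm_num,
      ENNReal.mul_inv (by simp) (by simp), ← mul_assoc, ENNReal.mul_inv_cancel (by simp) (by simp),
      one_mul]⟩
  simpa only [pow_two] using h.mul' (r := 2) h

theorem integral_pow_four (hX : IsCenteredGaussian μ X) :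
    ∫ ω, X ω ^ 4 ∂μ = 3 * (∫ ω, X ω ^ 2 ∂μ) ^ 2 := by
  obtain ⟨v, hv⟩ := hX
  have h4 := hv.integral_comp (f := fun x : ℝ => x ^ 4) (by fun_prop)
  have h2 := hv.integral_comp (f := fun x : ℝ => x ^ 2) (by fun_prop)
  have hvar : ∫ x, x ^ 2 ∂(gaussianReal 0 v) = v := by
    have := variance_fun_id_gaussianReal (μ := 0) (v := v)
    rw [variance_eq_integral measurable_id'.aemeasurable] at this
    simpa using this
  simp only [Function.comp_def] at h4 h2
  rw [h4, h2, hvar, integral_pow_four_gaussianReal]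

/-- Isserlis' formula for the squares of two jointly Gaussian centred variables. -/
theorem covariance_sq_sq [IsProbabilityMeasure μ] (hX : IsCenteredGaussian μ X)
    (hY : IsCenteredGaussian μ Y)
    (hadd : IsCenteredGaussian μ (X + Y)) (hsub : IsCenteredGaussian μ (X - Y)) :
    cov[fun ω => X ω ^ 2, fun ω => Y ω ^ 2; μ] = 2 * (∫ ω, X ω * Y ω ∂μ) ^ 2 := by
  have hXX : Integrable (fun ω => X ω ^ 2) μ := hX.memLp_sq.integrable (by norm_num)
  have hYY : Integrable (fun ω => Y ω ^ 2) μ := hY.memLp_sq.integrable (by norm_num)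
  have hXY : Integrable (fun ω => X ω * Y ω) μ :=
    (hX.memLp (p := 2) (by simp)).integrable_mul (hY.memLp (p := 2) (by simp))
  have i4 {Z : Ω → ℝ} (hZ : IsCenteredGaussian μ Z) : Integrable (fun ω => Z ω ^ 4) μ := by
    convert hZ.memLp_sq.integrable_sq using 2
    ring
  -- polarization: `(x + y)⁴ + (x - y)⁴ = 2 x⁴ + 12 x² y² + 2 y⁴`
  have key : ∫ ω, X ω ^ 2 * Y ω ^ 2 ∂μ = (∫ ω, (X + Y) ω ^ 4 ∂μ + ∫ ω, (X - Y) ω ^ 4 ∂μ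
      - 2 * ∫ ω, X ω ^ 4 ∂μ - 2 * ∫ ω, Y ω ^ 4 ∂μ) / 12 := by
    rw [← integral_add (i4 hadd) (i4 hsub), ← integral_const_mul, ← integral_const_mul,
      ← integral_sub ((i4 hadd).fun_add (i4 hsub)) ((i4 hX).const_mul 2),
      ← integral_sub (f := fun ω => (X + Y) ω ^ 4 + (X - Y) ω ^ 4 - 2 * X ω ^ 4)
        (((i4 hadd).fun_add (i4 hsub)).sub ((i4 hX).const_mul 2)) ((i4 hY).const_mul 2),
      ← integral_div]
    refine integral_congr_ae (ae_of_all _ fun ω => ?_)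
    simp only [Pi.add_apply, Pi.sub_apply]
    ring
  have hp : ∫ ω, (X + Y) ω ^ 2 ∂μ =
      ∫ ω, X ω ^ 2 ∂μ + 2 * ∫ ω, X ω * Y ω ∂μ + ∫ ω, Y ω ^ 2 ∂μ := by
    rw [← integral_const_mul, ← integral_add hXX (hXY.const_mul 2),
      ← integral_add (hXX.fun_add (hXY.const_mul 2)) hYY]
    refine integral_congr_ae (ae_of_all _ fun ω => ?_)
    simp only [Pi.add_apply]
    ring
  have hm : ∫ ω, (X - Y) ω ^ 2 ∂μ =
      ∫ ω, X ω ^ 2 ∂μ - 2 * ∫ ω, X ω * Y ω ∂μ + ∫ ω, Y ω ^ 2 ∂μ := by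
    rw [← integral_const_mul, ← integral_sub hXX (hXY.const_mul 2),
      ← integral_add (f := fun ω => X ω ^ 2 - 2 * (X ω * Y ω))
        (hXX.sub (hXY.const_mul 2)) hYY]
    refine integral_congr_ae (ae_of_all _ fun ω => ?_)
    simp only [Pi.sub_apply]
    ring
  rw [covariance_eq_sub hX.memLp_sq hY.memLp_sq]
  simp only [Pi.mul_apply]
  rw [key, hadd.integral_pow_four, hsub.integral_pow_four, hX.integral_pow_four,
    hY.integral_pow_four, hp, hm]
  ring

/-- Almost sure limits of centred Gaussian variables are centred Gaussian: the characteristic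
functions `exp (-vₙ θ² / 2)` converge to one that is continuous and `1` at `0`, which forces the
variances `vₙ` to converge. -/
theorem of_tendsto [IsProbabilityMeasure μ] {Z : ℕ → Ω → ℝ} (hZ : ∀ n, IsCenteredGaussian μ (Z n))
    (hlim : ∀ᵐ ω ∂μ, Tendsto (fun n => Z n ω) atTop (𝓝 (X ω))) : IsCenteredGaussian μ X := by
  choose v hv using hZ
  have hXm : AEMeasurable X μ := aemeasurable_of_tendsto_metrizable_ae atTop
    (fun n => (hv n).aemeasurable) hlim
  have hlimφ (θ : ℝ) : Tendsto (fun n => charFun (gaussianReal 0 (v n)) θ) atTop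
      (𝓝 (charFun (μ.map X) θ)) := by
    have e (n : ℕ) : charFun (gaussianReal 0 (v n)) θ =
        ∫ ω, Complex.exp (θ * Z n ω * Complex.I) ∂μ := by
      rw [← (hv n).map_eq, charFun_apply_real, integral_map (hv n).aemeasurable (by fun_prop)]
    simp_rw [e]
    rw [charFun_apply_real, integral_map hXm (by fun_prop)]
    refine tendsto_integral_of_dominated_convergence (fun _ => 1) (fun n => ?_)
      (integrable_const _) (fun n => ae_of_all _ fun ω => ?_) ?_
    · have := (hv n).aemeasurable
      exact (by fun_prop : AEMeasurable (fun ω => Complex.exp (θ * Z n ω * Complex.I))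
        μ).aestronglyMeasurable
    · rw [← Complex.ofReal_mul, Complex.norm_exp_ofReal_mul_I]
    · filter_upwards [hlim] with ω hω
      have hc : Continuous fun x : ℝ => Complex.exp (θ * x * Complex.I) := by fun_prop
      exact (hc.tendsto _).comp hω
  -- The limiting characteristic function is real, and nonzero at some `θ ≠ 0`; taking logarithms
  -- there recovers the limit of the variances.
  have hφ (n : ℕ) (θ : ℝ) :
      charFun (gaussianReal 0 (v n)) θ = ((Real.exp (-(v n * θ ^ 2 / 2)) : ℝ) : ℂ) := by
    rw [charFun_gaussianReal]
    push_cast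
    congr 1
    simp
  have hprob : IsProbabilityMeasure (μ.map X) := Measure.isProbabilityMeasure_map hXm
  obtain ⟨θ, hθ0, hθ⟩ : ∃ θ : ℝ, θ ≠ 0 ∧ charFun (μ.map X) θ ≠ 0 := by
    have hc : Continuous (charFun (μ.map X)) := continuous_charFun
    have h0 : charFun (μ.map X) 0 ≠ 0 := by simp
    have hev : ∀ᶠ θ in 𝓝[≠] (0 : ℝ), charFun (μ.map X) θ ≠ 0 :=
      (hc.continuousAt.eventually_ne h0).filter_mono nhdsWithin_le_nhds
    obtain ⟨θ, h1, h2⟩ := (hev.and self_mem_nhdsWithin).exists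
    exact ⟨θ, h2, h1⟩
  have hre (θ : ℝ) : Tendsto (fun n => Real.exp (-(v n * θ ^ 2 / 2))) atTop
      (𝓝 (charFun (μ.map X) θ).re) := by
    have := (Complex.continuous_re.tendsto _).comp (hlimφ θ)
    simpa only [Function.comp_def, hφ, Complex.ofReal_re] using this
  have him (θ : ℝ) : (charFun (μ.map X) θ).im = 0 := by
    have := (Complex.continuous_im.tendsto _).comp (hlimφ θ)
    simp only [Function.comp_def, hφ, Complex.ofReal_im] at this
    exact tendsto_nhds_unique this tendsto_const_nhds
  have hre0 : (charFun (μ.map X) θ).re ≠ 0 := fun h => hθ (Complex.ext h (him θ))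
  have hvlim : Tendsto v atTop (𝓝 (-(2 / θ ^ 2) * Real.log (charFun (μ.map X) θ).re).toNNReal) := by
    have h1 := ((hre θ).log hre0).const_mul (-(2 / θ ^ 2))
    have h2 := (continuous_real_toNNReal.tendsto _).comp h1
    refine h2.congr fun n => ?_
    simp only [Function.comp_def, Real.log_exp]
    rw [← Real.toNNReal_coe (r := v n)]
    congr 1
    field_simp
    simp
  refine ⟨(-(2 / θ ^ 2) * Real.log (charFun (μ.map X) θ).re).toNNReal, hXm,
    Measure.ext_of_charFun (funext fun θ' => ?_)⟩
  refine tendsto_nhds_unique (hlimφ θ') ?_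
  simp only [charFun_gaussianReal]
  have hc : Continuous fun u : ℝ≥0 =>
      Complex.exp (θ' * (0 : ℝ) * Complex.I - (u : ℝ) * θ' ^ 2 / 2) := by fun_prop
  exact (hc.tendsto _).comp hvlim

end IsCenteredGaussian

end

section

variable {Ω : Type*} [MeasurableSpace Ω]

/-! ### Continuous modifications and Fubini's theorem along paths -/

/-- A process with almost surely continuous paths is almost surely equal, for all times at once, to
a jointly measurable process all of whose paths are continuous. -/
theorem exists_continuous_modification {μ : Measure Ω} {X : ℝ≥0 → Ω → ℝ}
    (hm : ∀ t, AEMeasurable (X t) μ) (hc : ∀ᵐ ω ∂μ, Continuous fun t => X t ω) :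
    ∃ Y : ℝ≥0 → Ω → ℝ, Measurable (Function.uncurry Y) ∧ (∀ ω, Continuous fun t => Y t ω) ∧
      ∀ᵐ ω ∂μ, ∀ t, X t ω = Y t ω := by
  classical
  set d : ℕ → ℝ≥0 := TopologicalSpace.denseSeq ℝ≥0
  have hall : ∀ᵐ ω ∂μ, (Continuous fun t => X t ω) ∧ ∀ n, X (d n) ω = (hm (d n)).mk _ ω :=
    hc.and (ae_all_iff.2 fun n => (hm (d n)).ae_eq_mk)
  obtain ⟨G, hGm, hGae, hG⟩ : ∃ G : Set Ω, MeasurableSet G ∧ (∀ᵐ ω ∂μ, ω ∈ G) ∧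
      ∀ ω ∈ G, (Continuous fun t => X t ω) ∧ ∀ n, X (d n) ω = (hm (d n)).mk _ ω := by
    refine ⟨(toMeasurable μ {ω | ¬ ((Continuous fun t => X t ω) ∧
      ∀ n, X (d n) ω = (hm (d n)).mk _ ω)})ᶜ, (measurableSet_toMeasurable _ _).compl, ?_, ?_⟩
    · rw [ae_iff]
      have hall' := ae_iff.1 hall
      rw [← measure_toMeasurable] at hall'
      convert hall' using 2
      ext ω
      simp
    · intro ω hω
      by_contra h
      exact hω (subset_toMeasurable _ _ h)
  -- On the full-measure event `G` the path is continuous and agrees with measurable versions along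
  -- a dense sequence of times, which makes `Y t` a limit of measurable functions.
  set Y : ℝ≥0 → Ω → ℝ := fun t => G.indicator (X t) with hY
  have hYc (ω : Ω) : Continuous fun t => Y t ω := by
    by_cases hω : ω ∈ G
    · simpa only [hY, Set.indicator_of_mem hω] using (hG ω hω).1
    · simpa only [hY, Set.indicator_of_notMem hω] using continuous_const
  have hYd (n : ℕ) : Measurable (Y (d n)) := by
    have : Y (d n) = G.indicator ((hm (d n)).mk _) :=
      Set.indicator_congr fun ω hω => (hG ω hω).2 n
    rw [this]
    exact (hm (d n)).measurable_mk.indicator hGm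
  have hYm (t : ℝ≥0) : Measurable (Y t) := by
    obtain ⟨u, hu, hut⟩ := mem_closure_iff_seq_limit.1 (TopologicalSpace.denseRange_denseSeq ℝ≥0 t)
    choose n hn using hu
    refine measurable_of_tendsto_metrizable (fun k => hYd (n k)) (tendsto_pi_nhds.2 fun ω => ?_)
    simp only [d, hn]
    exact ((hYc ω).tendsto t).comp hut
  refine ⟨Y, measurable_uncurry_of_continuous_of_measurable (u := Y) hYc hYm, hYc, ?_⟩
  filter_upwards [hGae] with ω hω t
  rw [hY]
  exact (Set.indicator_of_mem hω _).symm

/-- Fubini's theorem for the time integral of a jointly measurable process with a uniform `L¹`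
bound. -/
theorem integrable_and_integral_intervalIntegral {μ : Measure Ω} [IsProbabilityMeasure μ]
    {G : ℝ → Ω → ℝ} (hG : Measurable (Function.uncurry G)) {t C : ℝ} (ht : 0 ≤ t)
    (hint : ∀ s, 0 ≤ s → Integrable (G s) μ) (hC : ∀ s, 0 ≤ s → s ≤ t → ∫ ω, |G s ω| ∂μ ≤ C) :
    Integrable (fun ω => ∫ s in (0 : ℝ)..t, G s ω) μ ∧
      ∫ ω, (∫ s in (0 : ℝ)..t, G s ω) ∂μ = ∫ s in (0 : ℝ)..t, ∫ ω, G s ω ∂μ := by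
  have hprod : Integrable (Function.uncurry G) ((volume.restrict (Set.Ioc 0 t)).prod μ) := by
    rw [integrable_prod_iff hG.aestronglyMeasurable]
    refine ⟨?_, ?_⟩
    · filter_upwards [ae_restrict_mem measurableSet_Ioc] with s hs using hint s hs.1.le
    · refine Integrable.of_bound
        (hG.norm.stronglyMeasurable.integral_prod_right.aestronglyMeasurable) C ?_
      filter_upwards [ae_restrict_mem measurableSet_Ioc] with s hs
      rw [Real.norm_of_nonneg (integral_nonneg fun _ => norm_nonneg _)]
      exact hC s hs.1.le hs.2
  simp only [intervalIntegral.integral_of_le ht]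
  exact ⟨hprod.integral_prod_right, (integral_integral_swap hprod).symm⟩

/-! ### Riemann sums -/

theorem tendsto_riemann_sum {g : ℝ → ℝ} (hg : Continuous g) {t : ℝ} (ht : 0 ≤ t) :
    Tendsto (fun n : ℕ => ∑ j ∈ Finset.range n, t / n * g (j * (t / n))) atTop
      (𝓝 (∫ s in (0 : ℝ)..t, g s)) := by
  have huc : UniformContinuousOn g (Set.Icc 0 t) :=
    isCompact_Icc.uniformContinuousOn_of_continuous hg.continuousOn
  rw [Metric.tendsto_atTop]
  intro ε hε
  obtain ⟨δ, hδ, hgδ⟩ := Metric.uniformContinuousOn_iff.1 huc (ε / (t + 1)) (by positivity)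
  obtain ⟨n₀, hn₀⟩ := exists_nat_gt (t / δ)
  refine ⟨n₀ + 1, fun n hn => ?_⟩
  have hnpos : (0 : ℝ) < n := by exact_mod_cast (by omega : 0 < n)
  have hstep : t / n < δ := by
    have h1 : (n₀ : ℝ) < n := by exact_mod_cast (by omega : n₀ < n)
    rw [div_lt_iff₀ hnpos]
    rw [div_lt_iff₀ hδ] at hn₀
    nlinarith
  have hstep0 : 0 ≤ t / n := by positivity
  have hsplit : ∫ s in (0 : ℝ)..t, g s =
      ∑ j ∈ Finset.range n, ∫ s in ((j : ℕ) * (t / n))..((j + 1 : ℕ) * (t / n)), g s := by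
    rw [intervalIntegral.sum_integral_adjacent_intervals (a := fun j : ℕ => j * (t / n))
      (fun k _ => hg.intervalIntegrable _ _)]
    congr 1
    · simp
    · field_simp
  have hpiece (j : ℕ) (hj : j ∈ Finset.range n) :
      |t / n * g (j * (t / n)) - ∫ s in ((j : ℕ) * (t / n))..((j + 1 : ℕ) * (t / n)), g s| ≤
        ε / (t + 1) * (t / n) := by
    have hj' : ((j + 1 : ℕ) : ℝ) ≤ n := by exact_mod_cast Finset.mem_range.1 hj
    have hle : (j : ℝ) * (t / n) ≤ (j + 1 : ℕ) * (t / n) := by push_cast; nlinarith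
    have hend : ((j + 1 : ℕ) : ℝ) * (t / n) ≤ t := by
      calc ((j + 1 : ℕ) : ℝ) * (t / n) ≤ n * (t / n) := by gcongr
        _ = t := by field_simp
    have hconst : t / n * g (j * (t / n)) =
        ∫ s in ((j : ℕ) * (t / n))..((j + 1 : ℕ) * (t / n)), g (j * (t / n)) := by
      rw [intervalIntegral.integral_const, smul_eq_mul]
      push_cast
      ring
    rw [hconst, ← intervalIntegral.integral_sub intervalIntegrable_const
      (hg.intervalIntegrable _ _), ← Real.norm_eq_abs]
    have hlen : |((j + 1 : ℕ) : ℝ) * (t / n) - (j : ℕ) * (t / n)| = t / n := by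
      rw [abs_of_nonneg (by linarith)]
      push_cast
      ring
    refine (intervalIntegral.norm_integral_le_of_norm_le_const (C := ε / (t + 1))
      fun s hs => ?_).trans_eq (by rw [hlen])
    rw [Set.uIoc_of_le hle] at hs
    have hj0 : 0 ≤ (j : ℝ) * (t / n) := by positivity
    have h2 : s - j * (t / n) ≤ t / n := by
      have := hs.2
      push_cast at this
      linarith
    rw [← dist_eq_norm]
    refine (hgδ _ ⟨hj0, by linarith⟩ s ⟨by linarith [hs.1], by linarith [hs.2]⟩ ?_).le
    rw [dist_comm, Real.dist_eq, abs_of_pos (by linarith [hs.1])]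
    linarith
  rw [Real.dist_eq, hsplit, ← Finset.sum_sub_distrib]
  calc _ ≤ ∑ j ∈ Finset.range n, ε / (t + 1) * (t / n) :=
        (Finset.abs_sum_le_sum_abs _ _).trans (Finset.sum_le_sum hpiece)
    _ = ε * (t / (t + 1)) := by
        rw [Finset.sum_const, Finset.card_range, nsmul_eq_mul]
        field_simp
    _ < ε := by
        have : t / (t + 1) < 1 := by rw [div_lt_one (by linarith)]; linarith
        nlinarith

/-! ### Limits of linear functionals of a Brownian motion -/

/-- The linear space of almost sure limits of sequences of finite linear combinations of the
values of the process `w`. For a Brownian motion these are centred Gaussian, and jointly so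
because they form a linear space. -/
def limitSpan (μ : Measure Ω) (w : ℝ≥0 → Ω → ℝ) : Submodule ℝ (Ω → ℝ) where
  carrier := {Y | ∃ Z : ℕ → Ω → ℝ, (∀ n, Z n ∈ Submodule.span ℝ (Set.range w)) ∧
    ∀ᵐ ω ∂μ, Tendsto (fun n => Z n ω) atTop (𝓝 (Y ω))}
  zero_mem' := ⟨fun _ => 0, fun _ => Submodule.zero_mem _, ae_of_all _ fun _ => by simp⟩
  add_mem' := by
    rintro Y Y' ⟨Z, hZ, hY⟩ ⟨Z', hZ', hY'⟩
    refine ⟨fun n => Z n + Z' n, fun n => Submodule.add_mem _ (hZ n) (hZ' n), ?_⟩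
    filter_upwards [hY, hY'] with ω h h' using h.add h'
  smul_mem' := by
    rintro c Y ⟨Z, hZ, hY⟩
    refine ⟨fun n => c • Z n, fun n => Submodule.smul_mem _ c (hZ n), ?_⟩
    filter_upwards [hY] with ω h using h.const_smul c

variable {μ : Measure Ω} {w : ℝ≥0 → Ω → ℝ}

theorem eval_mem_limitSpan (t : ℝ≥0) : w t ∈ limitSpan μ w :=
  ⟨fun _ => w t, fun _ => Submodule.subset_span ⟨t, rfl⟩, ae_of_all _ fun _ => tendsto_const_nhds⟩

/-- Weighted time integrals of a continuous process are limits of Riemann sums. -/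
theorem integral_mem_limitSpan (hc : ∀ ω, Continuous fun t => w t ω) {f : ℝ → ℝ}
    (hf : Continuous f) {t : ℝ} (ht : 0 ≤ t) :
    (fun ω => ∫ s in (0 : ℝ)..t, f s * w s.toNNReal ω) ∈ limitSpan μ w := by
  refine ⟨fun n => ∑ j ∈ Finset.range n, (t / n * f (j * (t / n))) • w (j * (t / n)).toNNReal,
    fun n => Submodule.sum_mem _ fun j _ =>
      Submodule.smul_mem _ _ (Submodule.subset_span ⟨_, rfl⟩), ae_of_all _ fun ω => ?_⟩
  have hcont : Continuous fun s : ℝ => f s * w s.toNNReal ω :=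
    hf.mul ((hc ω).comp continuous_real_toNNReal)
  refine (tendsto_riemann_sum hcont ht).congr fun n => ?_
  simp only [Finset.sum_apply, Pi.smul_apply, smul_eq_mul]
  exact Finset.sum_congr rfl fun j _ => by ring

theorem isCenteredGaussian_of_mem_span (hw : IsPreBrownianReal w μ) {Y : Ω → ℝ}
    (hY : Y ∈ Submodule.span ℝ (Set.range w)) : IsCenteredGaussian μ Y := by
  obtain ⟨c, rfl⟩ := (Finsupp.mem_span_range_iff_exists_finsupp).1 hY
  have hlin : HasGaussianLaw (c.sum fun i a => a • w i) μ := by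
    have h := (hw.isGaussianProcess.hasGaussianLaw c.support).map
      (∑ i : c.support, c i • ContinuousLinearMap.proj i)
    refine h.congr (ae_of_all _ fun ω => ?_)
    simp [Finsupp.sum, Finset.sum_apply, ← Finset.sum_attach c.support]
  have hmean : ∫ ω, (c.sum fun i a => a • w i) ω ∂μ = 0 := by
    simp only [Finsupp.sum, Finset.sum_apply, Pi.smul_apply, smul_eq_mul]
    rw [integral_finsetSum _ fun i _ => (hw.integrable_eval i).const_mul _]
    refine Finset.sum_eq_zero fun i _ => ?_
    rw [integral_const_mul, hw.integral_eval, mul_zero]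
  refine ⟨Var[c.sum fun i a => a • w i; μ].toNNReal, hlin.aemeasurable, ?_⟩
  rw [hlin.map_eq_gaussianReal, hmean]

theorem isCenteredGaussian_of_mem_limitSpan [IsProbabilityMeasure μ] (hw : IsPreBrownianReal w μ)
    {Y : Ω → ℝ} (hY : Y ∈ limitSpan μ w) : IsCenteredGaussian μ Y := by
  obtain ⟨Z, hZ, hlim⟩ := hY
  exact .of_tendsto (fun n => isCenteredGaussian_of_mem_span hw (hZ n)) hlim

end

section

variable {Ω : Type*} [MeasurableSpace Ω]

/-! ### Variation of constants and the covariance kernel -/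

/-- Variation of constants, with the stochastic integral `∫₀ᵗ exp (a (t - s)) dw(s)` written in
its integrated-by-parts form. -/
theorem variation_of_constants {a σ : ℝ} {x w : ℝ≥0 → ℝ} (hx : Continuous x) (hw : Continuous w)
    (h : ∀ t : ℝ≥0, x t = a * (∫ s in (0 : ℝ)..t, x s.toNNReal) + σ * w t) (t : ℝ≥0) :
    x t = σ * (w t + a * ∫ s in (0 : ℝ)..t, Real.exp (a * (t - s)) * w s.toNNReal) := by
  have hxc : Continuous fun s : ℝ => x s.toNNReal := hx.comp continuous_real_toNNReal
  have hwc : Continuous fun s : ℝ => w s.toNNReal := hw.comp continuous_real_toNNReal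
  have hderiv : ∀ r ∈ Set.uIcc (0 : ℝ) t,
      HasDerivAt (fun r : ℝ => Real.exp (-(a * r)) * ∫ s in (0 : ℝ)..r, x s.toNNReal)
        (σ * (Real.exp (-(a * r)) * w r.toNNReal)) r := by
    intro r hr
    rw [Set.uIcc_of_le t.coe_nonneg] at hr
    have hy : HasDerivAt (fun r : ℝ => ∫ s in (0 : ℝ)..r, x s.toNNReal) (x r.toNNReal) r :=
      intervalIntegral.integral_hasDerivAt_right (hxc.intervalIntegrable _ _)
        (hxc.stronglyMeasurableAtFilter _ _) hxc.continuousAt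
    have he : HasDerivAt (fun r : ℝ => Real.exp (-(a * r))) (Real.exp (-(a * r)) * -(a * 1)) r :=
      (((hasDerivAt_id r).const_mul a).neg).exp
    refine (he.mul hy).congr_deriv ?_
    rw [h r.toNNReal, Real.coe_toNNReal r hr.1]
    ring
  have hFTC := intervalIntegral.integral_eq_sub_of_hasDerivAt hderiv
    (Continuous.intervalIntegrable (by fun_prop) _ _)
  simp only [intervalIntegral.integral_same, mul_zero, sub_zero,
    intervalIntegral.integral_const_mul] at hFTC
  have hexp (s : ℝ) : Real.exp (a * (t - s)) = Real.exp (a * t) * Real.exp (-(a * s)) := by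
    rw [← Real.exp_add]
    ring_nf
  have hy : ∫ s in (0 : ℝ)..t, x s.toNNReal =
      σ * ∫ s in (0 : ℝ)..t, Real.exp (a * (t - s)) * w s.toNNReal := by
    simp only [hexp, mul_assoc, intervalIntegral.integral_const_mul]
    rw [mul_left_comm, hFTC, ← mul_assoc, ← Real.exp_add]
    simp
  rw [h t, hy]
  ring

/-- The variance at time `s` of the Langevin process with drift `a` and unit noise. The integral
form needs no case distinction at `a = 0` and is visibly continuous in `a`. -/
def unitVariance (a s : ℝ) : ℝ := ∫ r in (0 : ℝ)..s, Real.exp (2 * a * r)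

theorem unitVariance_of_ne_zero {a : ℝ} (ha : a ≠ 0) (s : ℝ) :
    unitVariance a s = (Real.exp (2 * a * s) - 1) / (2 * a) := by
  rw [unitVariance, intervalIntegral.integral_comp_mul_left _ (by simpa using ha)]
  simp
  ring

theorem unitVariance_zero (s : ℝ) : unitVariance 0 s = s := by
  simp [unitVariance]

theorem integral_exp_mul_sub {a : ℝ} (ha : a ≠ 0) (t p q : ℝ) :
    ∫ u in p..q, Real.exp (a * (t - u)) =
      (Real.exp (a * (t - p)) - Real.exp (a * (t - q))) / a := by
  have h : ∀ u ∈ Set.uIcc p q, HasDerivAt (fun u : ℝ => -(Real.exp (a * (t - u)) / a))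
      (Real.exp (a * (t - u))) u := by
    intro u _
    have : HasDerivAt (fun u : ℝ => Real.exp (a * (t - u)))
        (Real.exp (a * (t - u)) * (a * (0 - 1))) u :=
      (((hasDerivAt_const u t).sub (hasDerivAt_id u)).const_mul a).exp
    refine (this.div_const a).neg.congr_deriv ?_
    field_simp
    simp
  rw [intervalIntegral.integral_eq_sub_of_hasDerivAt h
    (Continuous.intervalIntegrable (by fun_prop) _ _)]
  ring

/-- The covariance, for `σ = 1`, of the Langevin process at time `s` with the noise at time `r`: the
left-hand side is what variation of constants gives, as `min r u` is the covariance of the noise at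
times `r` and `u`. -/
theorem noise_covariance {a r s : ℝ} (ha : a ≠ 0) (hr : 0 ≤ r) (hs : 0 ≤ s) :
    min r s + a * ∫ u in (0 : ℝ)..s, Real.exp (a * (s - u)) * min r u =
      (Real.exp (a * s) - Real.exp (a * (s - min r s))) / a := by
  have hm : min r s ≤ s := min_le_right _ _
  have hm0 : 0 ≤ min r s := le_min hr hs
  have hint (p q : ℝ) : IntervalIntegrable (fun u => Real.exp (a * (s - u)) * min r u) volume p q :=
    Continuous.intervalIntegrable (by fun_prop) _ _
  rw [← intervalIntegral.integral_add_adjacent_intervals (hint 0 (min r s)) (hint _ s)]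
  have h1 : ∫ u in (0 : ℝ)..min r s, Real.exp (a * (s - u)) * min r u =
      -((min r s / a + 1 / a ^ 2) * Real.exp (a * (s - min r s))) + Real.exp (a * s) / a ^ 2 := by
    have hd : ∀ u ∈ Set.uIcc 0 (min r s),
        HasDerivAt (fun u : ℝ => -((u / a + 1 / a ^ 2) * Real.exp (a * (s - u))))
          (Real.exp (a * (s - u)) * min r u) u := by
      intro u hu
      rw [Set.uIcc_of_le hm0] at hu
      have he : HasDerivAt (fun u : ℝ => Real.exp (a * (s - u)))
          (Real.exp (a * (s - u)) * (a * (0 - 1))) u :=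
        (((hasDerivAt_const u s).sub (hasDerivAt_id u)).const_mul a).exp
      have hl : HasDerivAt (fun u : ℝ => u / a + 1 / a ^ 2) (1 / a) u :=
        ((hasDerivAt_id u).div_const a).add_const _
      refine (hl.mul he).neg.congr_deriv ?_
      rw [min_eq_right (hu.2.trans (min_le_left _ _))]
      field_simp
      ring
    rw [intervalIntegral.integral_eq_sub_of_hasDerivAt hd (hint _ _)]
    simp
    ring
  have h2 : ∫ u in (min r s)..s, Real.exp (a * (s - u)) * min r u =
      min r s * ((Real.exp (a * (s - min r s)) - 1) / a) := by
    have : ∫ u in (min r s)..s, Real.exp (a * (s - u)) * min r u =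
        ∫ u in (min r s)..s, Real.exp (a * (s - u)) * min r s := by
      refine intervalIntegral.integral_congr fun u hu => ?_
      rw [Set.uIcc_of_le hm] at hu
      congr 1
      rcases le_total r s with h | h
      · rw [min_eq_left h] at hu ⊢
        exact min_eq_left hu.1
      · rw [min_eq_right h] at hu ⊢
        rw [le_antisymm hu.2 hu.1, min_eq_right h]
    rw [this, intervalIntegral.integral_mul_const, integral_exp_mul_sub ha]
    simp
    ring
  rw [h1, h2]
  field_simp
  ring

/-- The covariance of the Langevin process with `σ = 1` at times `s ≤ t`: the covariances `K` with
the noise, inserted into the variation of constants formula at time `t`. -/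
theorem covariance_formula {a s t : ℝ} (hs : 0 ≤ s) (hst : s ≤ t) {K : ℝ → ℝ}
    (hK : ∀ r, 0 ≤ r →
      K r = min r s + a * ∫ u in (0 : ℝ)..s, Real.exp (a * (s - u)) * min r u) :
    K t + a * ∫ u in (0 : ℝ)..t, Real.exp (a * (t - u)) * K u =
      Real.exp (a * (t - s)) * unitVariance a s := by
  rcases eq_or_ne a 0 with rfl | ha
  · rw [hK t (hs.trans hst), unitVariance_zero]
    simp [hst]
  have hK' (r : ℝ) (hr : 0 ≤ r) :
      K r = (Real.exp (a * s) - Real.exp (a * (s - min r s))) / a := by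
    rw [hK r hr, noise_covariance ha hr hs]
  have hcongr : ∫ u in (0 : ℝ)..t, Real.exp (a * (t - u)) * K u = ∫ u in (0 : ℝ)..t,
      Real.exp (a * (t - u)) * ((Real.exp (a * s) - Real.exp (a * (s - min u s))) / a) := by
    refine intervalIntegral.integral_congr fun u hu => ?_
    rw [Set.uIcc_of_le (hs.trans hst)] at hu
    simp only [hK' u hu.1]
  have hint (p q : ℝ) : IntervalIntegrable (fun u => Real.exp (a * (t - u)) *
      ((Real.exp (a * s) - Real.exp (a * (s - min u s))) / a)) volume p q :=
    Continuous.intervalIntegrable (by fun_prop) _ _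
  have h1 : ∫ u in (0 : ℝ)..s, Real.exp (a * (t - u)) *
      ((Real.exp (a * s) - Real.exp (a * (s - min u s))) / a) =
      (Real.exp (a * s) * ((Real.exp (a * t) - Real.exp (a * (t - s))) / a) -
        (Real.exp (a * (t + s)) - Real.exp (a * (t - s))) / (2 * a)) / a := by
    have : ∫ u in (0 : ℝ)..s, Real.exp (a * (t - u)) *
        ((Real.exp (a * s) - Real.exp (a * (s - min u s))) / a) =
        ∫ u in (0 : ℝ)..s, (Real.exp (a * s) * Real.exp (a * (t - u)) -
          Real.exp (2 * a * ((t + s) / 2 - u))) / a := by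
      refine intervalIntegral.integral_congr fun u hu => ?_
      rw [Set.uIcc_of_le hs] at hu
      rw [min_eq_left hu.2, mul_div_assoc', mul_sub, ← Real.exp_add (a * (t - u)) (a * (s - u))]
      ring_nf
    rw [this, intervalIntegral.integral_div, intervalIntegral.integral_sub
      (Continuous.intervalIntegrable (by fun_prop) _ _)
      (Continuous.intervalIntegrable (by fun_prop) _ _), intervalIntegral.integral_const_mul,
      integral_exp_mul_sub ha, integral_exp_mul_sub (mul_ne_zero two_ne_zero ha)]
    ring_nf
  have h2 : ∫ u in s..t, Real.exp (a * (t - u)) *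
      ((Real.exp (a * s) - Real.exp (a * (s - min u s))) / a) =
      (Real.exp (a * (t - s)) - 1) / a * ((Real.exp (a * s) - 1) / a) := by
    have : ∫ u in s..t, Real.exp (a * (t - u)) *
        ((Real.exp (a * s) - Real.exp (a * (s - min u s))) / a) =
        ∫ u in s..t, Real.exp (a * (t - u)) * ((Real.exp (a * s) - 1) / a) := by
      refine intervalIntegral.integral_congr fun u hu => ?_
      rw [Set.uIcc_of_le hst] at hu
      simp [min_eq_right hu.1]
    rw [this, intervalIntegral.integral_mul_const, integral_exp_mul_sub ha]
    simp
  rw [hcongr, ← intervalIntegral.integral_add_adjacent_intervals (hint 0 s) (hint s t), h1, h2,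
    hK' t (hs.trans hst), min_eq_right hst, unitVariance_of_ne_zero ha]
  have e1 : Real.exp (a * (t + s)) = Real.exp (a * t) * Real.exp (a * s) := by
    rw [← Real.exp_add]; ring_nf
  have e2 : Real.exp (2 * a * s) = Real.exp (a * s) ^ 2 := by
    rw [← Real.exp_nat_mul]; ring_nf
  have e3 : Real.exp (a * t) = Real.exp (a * (t - s)) * Real.exp (a * s) := by
    rw [← Real.exp_add]; ring_nf
  rw [e1, e2, e3, sub_self, mul_zero, Real.exp_zero]
  field_simp
  ring

end

section

variable {Ω : Type*} [MeasurableSpace Ω]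

/-! ### The Langevin process as a Gaussian process -/

theorem unitVariance_le {a : ℝ} (ha : a ≤ 0) {s t : ℝ} (hs : 0 ≤ s) (hst : s ≤ t) :
    unitVariance a s ≤ t := by
  have h : unitVariance a s ≤ ∫ _ in (0 : ℝ)..s, (1 : ℝ) := by
    refine intervalIntegral.integral_mono_on hs (Continuous.intervalIntegrable (by fun_prop) _ _)
      (by simp) fun r hr => Real.exp_le_one_iff.2 ?_
    nlinarith [hr.1]
  simp at h
  linarith

theorem limitSpan_congr {μ : Measure Ω} {w : ℝ≥0 → Ω → ℝ} {Y Y' : Ω → ℝ}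
    (hY : Y ∈ limitSpan μ w) (h : ∀ᵐ ω ∂μ, Y ω = Y' ω) : Y' ∈ limitSpan μ w := by
  obtain ⟨Z, hZ, hlim⟩ := hY
  refine ⟨Z, hZ, ?_⟩
  filter_upwards [hlim, h] with ω hω h' using h' ▸ hω

theorem integral_mul_brownian {μ : Measure Ω} [IsProbabilityMeasure μ] {w : ℝ≥0 → Ω → ℝ}
    (hw : IsPreBrownianReal w μ) (s t : ℝ≥0) : ∫ ω, w s ω * w t ω ∂μ = min (s : ℝ) t := by
  have h := hw.covariance_eval s t
  rw [covariance_eq_sub (hw.isGaussianProcess.hasGaussianLaw_eval s).memLp_two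
    (hw.isGaussianProcess.hasGaussianLaw_eval t).memLp_two, hw.integral_eval, zero_mul,
    sub_zero] at h
  simpa using h

/-- `X` is a jointly measurable version of the Langevin process driven by the jointly measurable
Brownian motion `W`. The equation is replaced by its variation of constants form. -/
structure IsRegularLangevin (μ : Measure Ω) (a σ : ℝ) (W X : ℝ≥0 → Ω → ℝ) : Prop where
  brownian : IsPreBrownianReal W μ
  measurable_noise : Measurable (Function.uncurry W)
  measurable : Measurable (Function.uncurry X)
  mem_limitSpan : ∀ t, X t ∈ limitSpan μ W
  formula : ∀ᵐ ω ∂μ, ∀ t : ℝ≥0, X t ω =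
    σ * (W t ω + a * ∫ s in (0 : ℝ)..t, Real.exp (a * (t - s)) * W s.toNNReal ω)

theorem IsLangevinSolution.exists_regular {μ : Measure Ω} [IsProbabilityMeasure μ] {a σ : ℝ}
    {w x : ℝ≥0 → Ω → ℝ} (h : IsLangevinSolution μ a σ w x) :
    ∃ W X : ℝ≥0 → Ω → ℝ, IsRegularLangevin μ a σ W X ∧ ∀ᵐ ω ∂μ, ∀ t, x t ω = X t ω := by
  obtain ⟨W, hWm, hWc, hwW⟩ :=
    exists_continuous_modification h.wiener.aemeasurable h.wiener.cont
  have hW : IsPreBrownianReal W μ := h.wiener.toIsPreBrownianReal.congr fun t => by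
    filter_upwards [hwW] with ω hω using hω t
  have hsol : ∀ᵐ ω ∂μ, ∀ t : ℝ≥0, x t ω =
      σ * (W t ω + a * ∫ s in (0 : ℝ)..t, Real.exp (a * (t - s)) * W s.toNNReal ω) := by
    filter_upwards [h.cont, h.eqn, hwW] with ω hc he hω
    refine variation_of_constants hc (hWc ω) fun t => ?_
    rw [he t, hω t]
  have hmem (t : ℝ≥0) : x t ∈ limitSpan μ W := by
    have hI := integral_mem_limitSpan (μ := μ) hWc (f := fun s => Real.exp (a * (t - s)))
      (by fun_prop) t.coe_nonneg
    refine limitSpan_congr (Submodule.smul_mem _ σ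
      (Submodule.add_mem _ (eval_mem_limitSpan t) (Submodule.smul_mem _ a hI))) ?_
    filter_upwards [hsol] with ω hω
    rw [hω t]
    rfl
  have hxm (t : ℝ≥0) : AEMeasurable (x t) μ :=
    ((isCenteredGaussian_of_mem_limitSpan hW (hmem t)).memLp (p := 2)
      (by simp)).aestronglyMeasurable.aemeasurable
  obtain ⟨X, hXm, -, hxX⟩ := exists_continuous_modification hxm h.cont
  refine ⟨W, X, ⟨hW, hWm, hXm, fun t => limitSpan_congr (hmem t) ?_, ?_⟩, hxX⟩
  · filter_upwards [hxX] with ω hω using hω t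
  · filter_upwards [hxX, hsol] with ω hω hω' t
    rw [← hω t, hω' t]

namespace IsRegularLangevin

variable {μ : Measure Ω} {a σ : ℝ} {W X : ℝ≥0 → Ω → ℝ}

theorem memLp_noise (h : IsRegularLangevin μ a σ W X) (t : ℝ≥0) : MemLp (W t) 2 μ :=
  (h.brownian.hasLaw_eval t).hasGaussianLaw.memLp_two

theorem measurable_eval (h : IsRegularLangevin μ a σ W X) (t : ℝ≥0) : Measurable (X t) :=
  h.measurable.comp measurable_prodMk_left

theorem measurable_noise_eval (h : IsRegularLangevin μ a σ W X) (t : ℝ≥0) : Measurable (W t) :=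
  h.measurable_noise.comp measurable_prodMk_left

variable [IsProbabilityMeasure μ]

theorem isCenteredGaussian (h : IsRegularLangevin μ a σ W X) (t : ℝ≥0) :
    IsCenteredGaussian μ (X t) :=
  isCenteredGaussian_of_mem_limitSpan h.brownian (h.mem_limitSpan t)

/-- The variation of constants formula, tested against a square-integrable variable. -/
theorem integral_mul_eval (h : IsRegularLangevin μ a σ W X) (ha : a ≤ 0) {Y : Ω → ℝ}
    (hYm : Measurable Y) (hY : MemLp Y 2 μ) (t : ℝ≥0) :
    ∫ ω, Y ω * X t ω ∂μ = σ * (∫ ω, Y ω * W t ω ∂μ +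
      a * ∫ s in (0 : ℝ)..t, Real.exp (a * (t - s)) * ∫ ω, Y ω * W s.toNNReal ω ∂μ) := by
  have hYW (s : ℝ≥0) : Integrable (fun ω => Y ω * W s ω) μ := hY.integrable_mul (h.memLp_noise s)
  have hW2 (s : ℝ≥0) : ∫ ω, W s ω ^ 2 ∂μ = s := by
    simpa [pow_two] using integral_mul_brownian h.brownian s s
  have hGm : Measurable (Function.uncurry fun (s : ℝ) (ω : Ω) =>
      Real.exp (a * (t - s)) * (Y ω * W s.toNNReal ω)) := by
    have h1 : Measurable fun p : ℝ × Ω => W p.1.toNNReal p.2 :=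
      h.measurable_noise.comp (measurable_fst.real_toNNReal.prodMk measurable_snd)
    simp only [Function.uncurry_def]
    exact (by fun_prop : Measurable fun p : ℝ × Ω => Real.exp (a * (t - p.1))).mul
      ((hYm.comp measurable_snd).mul h1)
  -- As `a ≤ 0`, the kernel is at most `1`, and `|Y W_s| ≤ (Y² + W_s²) / 2`.
  have hbound (s : ℝ) (hs0 : 0 ≤ s) (hst : s ≤ t) :
      ∫ ω, |Real.exp (a * (t - s)) * (Y ω * W s.toNNReal ω)| ∂μ ≤ (∫ ω, Y ω ^ 2 ∂μ + t) / 2 := by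
    have hexp : Real.exp (a * (t - s)) ≤ 1 :=
      Real.exp_le_one_iff.2 (mul_nonpos_of_nonpos_of_nonneg ha (by linarith))
    have hle : ∫ ω, |Real.exp (a * (t - s)) * (Y ω * W s.toNNReal ω)| ∂μ ≤
        ∫ ω, (Y ω ^ 2 + W s.toNNReal ω ^ 2) / 2 ∂μ := by
      refine integral_mono ((hYW s.toNNReal).const_mul _).abs
        ((hY.integrable_sq.add (h.memLp_noise _).integrable_sq).div_const 2) fun ω => ?_
      simp only
      rw [abs_mul, abs_mul, abs_of_pos (Real.exp_pos _)]
      calc _ ≤ 1 * (|Y ω| * |W s.toNNReal ω|) := by gcongr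
        _ ≤ _ := by
          rw [← sq_abs (Y ω), ← sq_abs (W _ ω)]
          nlinarith [sq_nonneg (|Y ω| - |W s.toNNReal ω|)]
    refine hle.trans ?_
    rw [integral_div, integral_add hY.integrable_sq (h.memLp_noise _).integrable_sq, hW2,
      Real.coe_toNNReal s hs0]
    linarith
  obtain ⟨hI, hFub⟩ := integrable_and_integral_intervalIntegral (μ := μ) hGm t.coe_nonneg
    (fun s _ => (hYW s.toNNReal).const_mul _) hbound
  calc ∫ ω, Y ω * X t ω ∂μ = ∫ ω, (σ * (Y ω * W t ω) + σ * a * ∫ s in (0 : ℝ)..t,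
        Real.exp (a * (t - s)) * (Y ω * W s.toNNReal ω)) ∂μ := by
        refine integral_congr_ae ?_
        filter_upwards [h.formula] with ω hω
        have : ∫ s in (0 : ℝ)..t, Real.exp (a * (t - s)) * (Y ω * W s.toNNReal ω) =
            Y ω * ∫ s in (0 : ℝ)..t, Real.exp (a * (t - s)) * W s.toNNReal ω := by
          rw [← intervalIntegral.integral_const_mul]
          congr 1
          funext s
          ring
        rw [hω t, this]
        ring
    _ = _ := by
        rw [integral_add ((hYW t).const_mul σ) (hI.const_mul _), integral_const_mul,
          integral_const_mul, hFub]
        simp only [integral_const_mul]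
        ring

theorem integral_mul_noise (h : IsRegularLangevin μ a σ W X) (ha : a ≤ 0) (r s : ℝ≥0) :
    ∫ ω, X s ω * W r ω ∂μ = σ * (min (r : ℝ) s +
      a * ∫ u in (0 : ℝ)..s, Real.exp (a * (s - u)) * min (r : ℝ) u) := by
  simp only [mul_comm (X s _)]
  rw [h.integral_mul_eval ha (h.measurable_noise_eval r) (h.memLp_noise r) s,
    integral_mul_brownian h.brownian]
  congr 3
  refine intervalIntegral.integral_congr fun u hu => ?_
  rw [Set.uIcc_of_le s.coe_nonneg] at hu
  simp only [integral_mul_brownian h.brownian, Real.coe_toNNReal u hu.1]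

theorem integral_mul (h : IsRegularLangevin μ a σ W X) (ha : a ≤ 0) {s t : ℝ≥0} (hst : s ≤ t) :
    ∫ ω, X s ω * X t ω ∂μ = σ ^ 2 * (Real.exp (a * (t - s)) * unitVariance a s) := by
  rw [h.integral_mul_eval ha (h.measurable_eval s)
    ((h.isCenteredGaussian s).memLp (by simp)) t]
  set K : ℝ → ℝ := fun r => min r s +
    a * ∫ u in (0 : ℝ)..s, Real.exp (a * (s - u)) * min r u with hK
  rw [← covariance_formula (K := K) s.coe_nonneg (by exact_mod_cast hst) fun r _ => rfl]
  have hXW (r : ℝ) (hr : 0 ≤ r) : ∫ ω, X s ω * W r.toNNReal ω ∂μ = σ * K r := by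
    rw [h.integral_mul_noise ha, Real.coe_toNNReal r hr]
  have hcongr : ∫ u in (0 : ℝ)..t, Real.exp (a * (t - u)) * ∫ ω, X s ω * W u.toNNReal ω ∂μ =
      σ * ∫ u in (0 : ℝ)..t, Real.exp (a * (t - u)) * K u := by
    rw [← intervalIntegral.integral_const_mul]
    refine intervalIntegral.integral_congr fun u hu => ?_
    rw [Set.uIcc_of_le t.coe_nonneg] at hu
    simp only [hXW u hu.1]
    ring
  have ht := hXW t t.coe_nonneg
  rw [Real.toNNReal_coe] at ht
  rw [hcongr, ht]
  ring

theorem integral_sq (h : IsRegularLangevin μ a σ W X) (ha : a ≤ 0) (t : ℝ≥0) :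
    ∫ ω, X t ω ^ 2 ∂μ = σ ^ 2 * unitVariance a t := by
  simpa [pow_two] using h.integral_mul ha (le_refl t)

theorem covariance_sq (h : IsRegularLangevin μ a σ W X) (ha : a ≤ 0) {s t : ℝ≥0} (hst : s ≤ t) :
    cov[fun ω => X s ω ^ 2, fun ω => X t ω ^ 2; μ] =
      2 * σ ^ 4 * (Real.exp (2 * a * (t - s)) * unitVariance a s ^ 2) := by
  have hG {Y : Ω → ℝ} (hY : Y ∈ limitSpan μ W) : IsCenteredGaussian μ Y :=
    isCenteredGaussian_of_mem_limitSpan h.brownian hY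
  rw [IsCenteredGaussian.covariance_sq_sq (h.isCenteredGaussian s) (h.isCenteredGaussian t)
    (hG (Submodule.add_mem _ (h.mem_limitSpan s) (h.mem_limitSpan t)))
    (hG (Submodule.sub_mem _ (h.mem_limitSpan s) (h.mem_limitSpan t))), h.integral_mul ha hst]
  have : Real.exp (2 * a * (t - s)) = Real.exp (a * (t - s)) ^ 2 := by
    rw [← Real.exp_nat_mul]
    ring_nf
  rw [this]
  ring

theorem integrable_cost_and_expectedCost (h : IsRegularLangevin μ a σ W X) (ha : a ≤ 0) {T : ℝ}
    (hT : 0 ≤ T) : Integrable (cost X T) μ ∧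
      expectedCost μ X T = σ ^ 2 * ∫ t in (0 : ℝ)..T, unitVariance a t := by
  have hm : Measurable (Function.uncurry fun (s : ℝ) (ω : Ω) => X s.toNNReal ω ^ 2) := by
    have h1 : Measurable fun p : ℝ × Ω => X p.1.toNNReal p.2 :=
      h.measurable.comp (measurable_fst.real_toNNReal.prodMk measurable_snd)
    exact h1.pow_const 2
  have hbound (s : ℝ) (hs : 0 ≤ s) (hsT : s ≤ T) :
      ∫ ω, |X s.toNNReal ω ^ 2| ∂μ ≤ σ ^ 2 * T := by
    simp only [abs_sq, h.integral_sq ha, Real.coe_toNNReal s hs]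
    exact mul_le_mul_of_nonneg_left (unitVariance_le ha hs hsT) (sq_nonneg σ)
  obtain ⟨hI, hFub⟩ := integrable_and_integral_intervalIntegral (μ := μ) hm hT
    (fun s _ => ((h.isCenteredGaussian s.toNNReal).memLp (by simp)).integrable_sq) hbound
  refine ⟨hI, ?_⟩
  rw [← intervalIntegral.integral_const_mul]
  refine hFub.trans (intervalIntegral.integral_congr fun s hs => ?_)
  rw [Set.uIcc_of_le hT] at hs
  simp only [h.integral_sq ha, Real.coe_toNNReal s hs.1]

end IsRegularLangevin

end

section

variable {Ω : Type*} [MeasurableSpace Ω]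

/-! ### Bias and variance as functions of the drift -/

/-- The bias of the Riemann sum of one trajectory, with horizon `N h`, as a function of the
drift `a`. -/
def bias (σ h : ℝ) (N : ℕ) (a : ℝ) : ℝ :=
  σ ^ 2 * (∑ k ∈ Finset.range N, h * unitVariance a (k * h) -
    ∫ t in (0 : ℝ)..(N * h), unitVariance a t)

/-- The variance of the Riemann sum of one trajectory as a function of the drift `a`: the sum over
all pairs of grid points of the covariances of the squares. -/
def riemannVariance (σ h : ℝ) (N : ℕ) (a : ℝ) : ℝ :=
  2 * σ ^ 4 * h ^ 2 * ∑ k ∈ Finset.range N, ∑ l ∈ Finset.range N,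
    Real.exp (2 * a * h) ^ (max k l - min k l) * unitVariance a ((min k l : ℕ) * h) ^ 2

theorem continuous_uncurry_unitVariance :
    Continuous (Function.uncurry fun a s : ℝ => unitVariance a s) :=
  intervalIntegral.continuous_parametric_primitive_of_continuous
    (f := fun a r : ℝ => Real.exp (2 * a * r)) (by fun_prop)

theorem continuous_unitVariance (s : ℝ) : Continuous fun a : ℝ => unitVariance a s :=
  continuous_uncurry_unitVariance.comp (by fun_prop : Continuous fun a : ℝ => (a, s))

theorem continuous_bias (σ h : ℝ) (N : ℕ) : Continuous (bias σ h N) := by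
  have h1 : Continuous fun a : ℝ => ∫ t in (0 : ℝ)..(N * h), unitVariance a t :=
    intervalIntegral.continuous_parametric_intervalIntegral_of_continuous'
      continuous_uncurry_unitVariance _ _
  refine continuous_const.mul (Continuous.sub ?_ h1)
  exact continuous_finsetSum _ fun k _ => continuous_const.mul (continuous_unitVariance _)

theorem continuous_riemannVariance (σ h : ℝ) (N : ℕ) : Continuous (riemannVariance σ h N) := by
  refine continuous_const.mul (continuous_finsetSum _ fun k _ => continuous_finsetSum _
    fun l _ => Continuous.mul ?_ ((continuous_unitVariance _).pow 2))
  fun_prop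

theorem sum_sum_range_succ (F : ℕ → ℕ → ℝ) (hF : ∀ k l, F k l = F l k) (N : ℕ) :
    ∑ k ∈ Finset.range (N + 1), ∑ l ∈ Finset.range (N + 1), F k l =
      ∑ k ∈ Finset.range N, ∑ l ∈ Finset.range N, F k l + 2 * ∑ k ∈ Finset.range N, F k N +
        F N N := by
  simp only [Finset.sum_range_succ, Finset.sum_add_distrib]
  rw [Finset.sum_congr rfl fun l _ => hF N l]
  ring

/-- The off-diagonal part of the row that the double sum in `sum_sum_pow_mul_sq` gains when `N` grows
by one. -/
theorem sum_pow_mul_sq (q : ℝ) (N : ℕ) :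
    (q - 1) * ∑ k ∈ Finset.range N, q ^ (N - k) * (q ^ k - 1) ^ 2 =
      q ^ N * (q ^ N - 1 - 2 * N * (q - 1)) + q * (q ^ N - 1) := by
  induction N with
  | zero => simp
  | succ N ih =>
    have hstep : ∑ k ∈ Finset.range N, q ^ (N + 1 - k) * (q ^ k - 1) ^ 2 =
        q * ∑ k ∈ Finset.range N, q ^ (N - k) * (q ^ k - 1) ^ 2 := by
      rw [Finset.mul_sum]
      refine Finset.sum_congr rfl fun k hk => ?_
      rw [Nat.succ_sub (Finset.mem_range.1 hk).le, pow_succ]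
      ring
    rw [Finset.sum_range_succ, hstep, mul_add, mul_left_comm, ih, Nat.add_sub_cancel_left]
    push_cast
    ring

/-- The sum behind `E₂`, multiplied by `(q - 1)²` to stay free of division. -/
theorem sum_sum_pow_mul_sq (q : ℝ) (N : ℕ) :
    (q - 1) ^ 2 * ∑ k ∈ Finset.range N, ∑ l ∈ Finset.range N,
        q ^ (max k l - min k l) * (q ^ (min k l) - 1) ^ 2 =
      (q ^ N - 1) * (4 * q + q ^ N + 1) - N * (q - 1) * (q + 4 * q ^ N + 1) := by
  induction N with
  | zero => simp
  | succ N ih =>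
    have hrow : ∑ k ∈ Finset.range N, q ^ (max k N - min k N) * (q ^ (min k N) - 1) ^ 2 =
        ∑ k ∈ Finset.range N, q ^ (N - k) * (q ^ k - 1) ^ 2 := by
      refine Finset.sum_congr rfl fun k hk => ?_
      rw [max_eq_right (Finset.mem_range.1 hk).le, min_eq_left (Finset.mem_range.1 hk).le]
    rw [sum_sum_range_succ (fun k l => q ^ (max k l - min k l) * (q ^ (min k l) - 1) ^ 2)
      (fun k l => by rw [max_comm, min_comm]), hrow, mul_add, mul_add, ih]
    have h := sum_pow_mul_sq q N
    have h' : (q - 1) ^ 2 * (2 * ∑ k ∈ Finset.range N, q ^ (N - k) * (q ^ k - 1) ^ 2) =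
        2 * (q - 1) * (q ^ N * (q ^ N - 1 - 2 * N * (q - 1)) + q * (q ^ N - 1)) := by
      rw [← h]
      ring
    rw [h', max_self, min_self, Nat.sub_self]
    push_cast
    ring

theorem sum_sum_min_sq (N : ℕ) :
    ∑ k ∈ Finset.range N, ∑ l ∈ Finset.range N, (((min k l : ℕ) : ℝ)) ^ 2 =
      ((N : ℝ) ^ 4 - 2 * N ^ 3 + 2 * N ^ 2 - N) / 6 := by
  induction N with
  | zero => simp
  | succ N ih =>
    have hsq : ∑ k ∈ Finset.range N, ((k : ℝ)) ^ 2 = (N : ℝ) * (N - 1) * (2 * N - 1) / 6 := by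
      clear ih
      induction N with
      | zero => simp
      | succ N ih => rw [Finset.sum_range_succ, ih]; push_cast; ring
    have hrow : ∑ k ∈ Finset.range N, (((min k N : ℕ) : ℝ)) ^ 2 =
        ∑ k ∈ Finset.range N, ((k : ℝ)) ^ 2 :=
      Finset.sum_congr rfl fun k hk => by rw [min_eq_left (Finset.mem_range.1 hk).le]
    rw [sum_sum_range_succ (fun k l => (((min k l : ℕ) : ℝ)) ^ 2)
      (fun k l => by rw [min_comm]), hrow, ih, hsq, min_self]
    push_cast
    ring

theorem exp_two_mul_nat (a h : ℝ) (k : ℕ) :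
    Real.exp (2 * a * (k * h)) = Real.exp (2 * a * h) ^ k := by
  rw [← Real.exp_nat_mul]
  ring_nf

theorem E₁_eq_bias_sq {σ h a : ℝ} (N : ℕ) (ha : a ≠ 0) (hh : 0 < h) :
    E₁ σ h (N * h) a = bias σ h N a ^ 2 := by
  have hq : Real.exp (2 * a * h) - 1 ≠ 0 := by
    simp [sub_eq_zero, Real.exp_eq_one_iff, ha, hh.ne']
  have hsum : ∑ k ∈ Finset.range N, h * unitVariance a (k * h) =
      h / (2 * a) * ((Real.exp (2 * a * h) ^ N - 1) / (Real.exp (2 * a * h) - 1) - N) := by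
    rw [← geom_sum_eq (sub_ne_zero.1 hq)]
    simp only [unitVariance_of_ne_zero ha, exp_two_mul_nat]
    rw [← Finset.mul_sum, ← Finset.sum_div, Finset.sum_sub_distrib]
    simp
    ring
  have hint : ∫ t in (0 : ℝ)..(N * h), unitVariance a t =
      ((Real.exp (2 * a * h) ^ N - 1) / (2 * a) - N * h) / (2 * a) := by
    simp only [unitVariance_of_ne_zero ha]
    rw [intervalIntegral.integral_div, intervalIntegral.integral_sub
      (Continuous.intervalIntegrable (by fun_prop) _ _) (by simp)]
    have := unitVariance_of_ne_zero ha (N * h)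
    rw [unitVariance] at this
    rw [this, exp_two_mul_nat]
    simp
  rw [E₁, bias, hsum, hint, exp_two_mul_nat]
  field_simp
  ring

theorem E₂_eq_riemannVariance {σ h a : ℝ} (N : ℕ) (ha : a ≠ 0) (hh : 0 < h) :
    E₂ σ h (N * h) a = N * riemannVariance σ h N a := by
  have hq : Real.exp (2 * a * h) - 1 ≠ 0 := by
    simp [sub_eq_zero, Real.exp_eq_one_iff, ha, hh.ne']
  have hsum := sum_sum_pow_mul_sq (Real.exp (2 * a * h)) N
  have hsum' : ∑ k ∈ Finset.range N, ∑ l ∈ Finset.range N,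
      Real.exp (2 * a * h) ^ (max k l - min k l) * unitVariance a ((min k l : ℕ) * h) ^ 2 =
      (∑ k ∈ Finset.range N, ∑ l ∈ Finset.range N, Real.exp (2 * a * h) ^ (max k l - min k l) *
        (Real.exp (2 * a * h) ^ (min k l) - 1) ^ 2) / (2 * a) ^ 2 := by
    simp only [Finset.sum_div]
    refine Finset.sum_congr rfl fun k _ => Finset.sum_congr rfl fun l _ => ?_
    rw [unitVariance_of_ne_zero ha, exp_two_mul_nat, div_pow, mul_div_assoc]
  rw [E₂, riemannVariance, hsum', exp_two_mul_nat, eq_div_of_mul_eq (pow_ne_zero 2 hq)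
    ((mul_comm _ _).trans hsum)]
  field_simp

theorem bias_zero (σ h : ℝ) (N : ℕ) : bias σ h N 0 = -(σ ^ 2 * (N * h) * h / 2) := by
  have hs : ∑ k ∈ Finset.range N, h * ((k : ℝ) * h) = h ^ 2 * (N * (N - 1) / 2) := by
    induction N with
    | zero => simp
    | succ N ih => rw [Finset.sum_range_succ, ih]; push_cast; ring
  simp only [bias, unitVariance_zero, hs, integral_id]
  ring

theorem riemannVariance_zero (σ h : ℝ) (N : ℕ) : riemannVariance σ h N 0 =
    2 * σ ^ 4 * h ^ 4 * (((N : ℝ) ^ 4 - 2 * N ^ 3 + 2 * N ^ 2 - N) / 6) := by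
  have : ∑ k ∈ Finset.range N, ∑ l ∈ Finset.range N, (((min k l : ℕ) : ℝ) * h) ^ 2 =
      h ^ 2 * ∑ k ∈ Finset.range N, ∑ l ∈ Finset.range N, (((min k l : ℕ) : ℝ)) ^ 2 := by
    simp only [Finset.mul_sum]
    exact Finset.sum_congr rfl fun k _ => Finset.sum_congr rfl fun l _ => by ring
  simp only [riemannVariance, unitVariance_zero, mul_zero, zero_mul, Real.exp_zero, one_pow,
    one_mul]
  rw [this, sum_sum_min_sq]
  ring

end

section

variable {Ω : Type*} [MeasurableSpace Ω]

/-! ### The Monte-Carlo estimator -/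

variable {μ : Measure Ω} [IsProbabilityMeasure μ] {a σ : ℝ}

theorem IsRegularLangevin.covariance_sq_grid {W X : ℝ≥0 → Ω → ℝ}
    (hX : IsRegularLangevin μ a σ W X) (ha : a ≤ 0) {h : ℝ} (hh : 0 ≤ h) (k l : ℕ) :
    cov[fun ω => X (k * h).toNNReal ω ^ 2, fun ω => X (l * h).toNNReal ω ^ 2; μ] =
      2 * σ ^ 4 * (Real.exp (2 * a * h) ^ (max k l - min k l) *
        unitVariance a ((min k l : ℕ) * h) ^ 2) := by
  wlog hkl : k ≤ l generalizing k l
  · rw [covariance_comm, this l k (by omega), max_comm, min_comm]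
  have hk : 0 ≤ (k : ℝ) * h := by positivity
  have hl : 0 ≤ (l : ℝ) * h := by positivity
  rw [hX.covariance_sq ha (Real.toNNReal_le_toNNReal (by gcongr)), Real.coe_toNNReal _ hk,
    Real.coe_toNNReal _ hl, max_eq_right hkl, min_eq_left hkl, ← Real.exp_nat_mul,
    Nat.cast_sub hkl]
  ring_nf

variable {w x : ℝ≥0 → Ω → ℝ}

theorem IsLangevinSolution.integrable_cost_and_expectedCost (hx : IsLangevinSolution μ a σ w x)
    (ha : a ≤ 0) {T : ℝ} (hT : 0 ≤ T) : Integrable (cost x T) μ ∧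
      expectedCost μ x T = σ ^ 2 * ∫ t in (0 : ℝ)..T, unitVariance a t := by
  obtain ⟨W, X, hX, hxX⟩ := hx.exists_regular
  have hae : cost X T =ᵐ[μ] cost x T := by
    filter_upwards [hxX] with ω hω
    simp only [cost, hω]
  obtain ⟨hI, hV⟩ := hX.integrable_cost_and_expectedCost ha hT
  exact ⟨hI.congr hae, (integral_congr_ae hae).symm.trans hV⟩

theorem IsLangevinSolution.riemannSum_moments (hx : IsLangevinSolution μ a σ w x) (ha : a ≤ 0)
    {h : ℝ} (hh : 0 ≤ h) (N : ℕ) :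
    MemLp (riemannSum x h N) 2 μ ∧
      ∫ ω, riemannSum x h N ω ∂μ =
        σ ^ 2 * ∑ k ∈ Finset.range N, h * unitVariance a (k * h) ∧
      Var[riemannSum x h N; μ] = riemannVariance σ h N a := by
  obtain ⟨W, X, hX, hxX⟩ := hx.exists_regular
  have hae : riemannSum X h N =ᵐ[μ] riemannSum x h N := by
    filter_upwards [hxX] with ω hω
    simp only [riemannSum, hω]
  have hterm (k : ℕ) : MemLp (fun ω => h * X (k * h).toNNReal ω ^ 2) 2 μ :=
    (hX.isCenteredGaussian _).memLp_sq.const_mul h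
  refine ⟨(memLp_finsetSum _ fun k _ => hterm k).ae_eq hae, ?_, ?_⟩
  · rw [← integral_congr_ae hae]
    simp only [riemannSum]
    rw [integral_finsetSum _ fun k _ => (hterm k).integrable (by norm_num), Finset.mul_sum]
    refine Finset.sum_congr rfl fun k _ => ?_
    rw [integral_const_mul, hX.integral_sq ha, Real.coe_toNNReal _ (by positivity)]
    ring
  · rw [← variance_congr hae, ← covariance_self (X := riemannSum X h N)
      (memLp_finsetSum _ fun k _ => hterm k).aestronglyMeasurable.aemeasurable]
    unfold riemannSum
    rw [covariance_fun_sum_fun_sum' (fun k _ => hterm k) (fun k _ => hterm k), riemannVariance,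
      Finset.mul_sum]
    refine Finset.sum_congr rfl fun k _ => ?_
    rw [Finset.mul_sum]
    refine Finset.sum_congr rfl fun l _ => ?_
    rw [covariance_const_mul_left, covariance_const_mul_right, hX.covariance_sq_grid ha hh]
    ring

variable {M : ℕ} {w x : Fin M → ℝ≥0 → Ω → ℝ}

theorem memLp_mcEstimator (hx : ∀ i, IsLangevinSolution μ a σ (w i) (x i)) (ha : a ≤ 0) {h : ℝ}
    (hh : 0 ≤ h) (N : ℕ) : MemLp (mcEstimator x h N) 2 μ :=
  (memLp_finsetSum _ fun i _ => ((hx i).riemannSum_moments ha hh N).1).const_mul _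

/-- Bias-variance decomposition: only the variance is reduced by averaging over the independent
trajectories. -/
theorem mse_eq_bias_sq_add (hx : ∀ i, IsLangevinSolution μ a σ (w i) (x i))
    (hindep : iIndepFun (fun (i : Fin M) (ω : Ω) (t : ℝ≥0) => x i t ω) μ) (ha : a ≤ 0) {h : ℝ}
    (hh : 0 ≤ h) (hM : M ≠ 0) (N : ℕ) (i : Fin M) :
    mse μ x h N (expectedCost μ (x i) (N * h)) =
      bias σ h N a ^ 2 + riemannVariance σ h N a / M := by
  have hM' : (M : ℝ) ≠ 0 := by exact_mod_cast hM
  have hL := memLp_mcEstimator hx ha hh N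
  have hR (j : Fin M) := (hx j).riemannSum_moments ha hh N
  have hmean : ∫ ω, mcEstimator x h N ω ∂μ =
      σ ^ 2 * ∑ k ∈ Finset.range N, h * unitVariance a (k * h) := by
    simp only [mcEstimator]
    rw [integral_const_mul, integral_finsetSum _ fun j _ => (hR j).1.integrable (by norm_num)]
    simp only [(hR _).2.1, Finset.sum_const, Finset.card_univ, Fintype.card_fin, nsmul_eq_mul]
    field_simp
  have hvar : Var[mcEstimator x h N; μ] = riemannVariance σ h N a / M := by
    have hind : iIndepFun (fun j => riemannSum (x j) h N) μ :=
      hindep.comp (fun _ y => ∑ k ∈ Finset.range N, h * y (k * h).toNNReal ^ 2)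
        fun _ => by fun_prop
    have hs := IndepFun.variance_sum (s := Finset.univ) (fun j _ => (hR j).1)
      fun j _ l _ hjl => hind.indepFun hjl
    have he : mcEstimator x h N = fun ω => (1 / (M : ℝ)) * (∑ j, riemannSum (x j) h N) ω := by
      funext ω
      simp [mcEstimator]
    rw [he, variance_const_mul, hs]
    simp only [(hR _).2.2, Finset.sum_const, Finset.card_univ, Fintype.card_fin, nsmul_eq_mul]
    field_simp
  rw [variance_eq_sub hL, hmean] at hvar
  have hV := ((hx i).integrable_cost_and_expectedCost ha (T := N * h) (by positivity)).2
  have hexp (V : ℝ) : mse μ x h N V = ∫ ω, mcEstimator x h N ω ^ 2 ∂μ -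
      2 * V * ∫ ω, mcEstimator x h N ω ∂μ + V ^ 2 := by
    have hI : Integrable (fun ω => 2 * V * mcEstimator x h N ω) μ :=
      (hL.integrable (by norm_num)).const_mul _
    rw [← integral_const_mul, ← integral_sub hL.integrable_sq hI]
    have hc : V ^ 2 = ∫ _, V ^ 2 ∂μ := by simp
    rw [hc, ← integral_add (f := fun ω => mcEstimator x h N ω ^ 2 - 2 * V * mcEstimator x h N ω)
      (hL.integrable_sq.sub hI) (integrable_const _), mse]
    congr 1
    funext ω
    ring
  simp only [Pi.pow_apply] at hvar
  rw [hexp, hmean, hV, bias]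
  linear_combination hvar

end

end LangevinMC

end

theorem theorem1 {Ω : Type*} [MeasurableSpace Ω] (μ : Measure Ω) [IsProbabilityMeasure μ]
    (a σ h T : ℝ) (M N B : ℕ) (ha : a ≤ 0) (hσ : 0 < σ) (hh : 0 < h)
    (hM : 1 ≤ M) (hN : 1 ≤ N) (hT : T = N * h) (hB : B = M * N)
    (w x : Fin M → ℝ≥0 → Ω → ℝ)
    (hx : ∀ i, LangevinMC.IsLangevinSolution μ a σ (w i) (x i))
    (hindep : iIndepFun (fun (i : Fin M) (ω : Ω) (t : ℝ≥0) => x i t ω) μ) :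
    (∀ i, Integrable (LangevinMC.cost (x i) T) μ) ∧
    (∀ i, Integrable (fun ω => (LangevinMC.mcEstimator x h N ω -
      LangevinMC.expectedCost μ (x i) T) ^ 2) μ) ∧
    (a < 0 → ∀ i, LangevinMC.mse μ x h N (LangevinMC.expectedCost μ (x i) T) =
      LangevinMC.E₁ σ h T a + LangevinMC.E₂ σ h T a / B) ∧
    (a = 0 → ∃ e₁ e₂ : ℝ,
      e₁ = σ ^ 4 * T ^ 2 / 4 * h ^ 2 ∧
      e₂ = σ ^ 4 * T ^ 5 / (3 * h) + σ ^ 4 * T ^ 2 * (-2 * T ^ 2 + 2 * h * T - h ^ 2) / 3 ∧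
      Tendsto (fun b => LangevinMC.E₁ σ h T b) (𝓝[≠] 0) (𝓝 e₁) ∧
      Tendsto (fun b => LangevinMC.E₂ σ h T b) (𝓝[≠] 0) (𝓝 e₂) ∧
      ∀ i, LangevinMC.mse μ x h N (LangevinMC.expectedCost μ (x i) T) = e₁ + e₂ / B) := by
  open LangevinMC in
  have hMne : M ≠ 0 := by omega
  have hM0 : (M : ℝ) ≠ 0 := by exact_mod_cast hMne
  have hN0 : (N : ℝ) ≠ 0 := by exact_mod_cast (by omega : N ≠ 0)
  have hBc : (B : ℝ) = M * N := by rw [hB]; push_cast; rfl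
  have hmse := mse_eq_bias_sq_add hx hindep ha hh.le hMne N
  have hT0 : 0 ≤ T := by rw [hT]; positivity
  refine ⟨fun i => ((hx i).integrable_cost_and_expectedCost ha hT0).1,
    fun i => ((memLp_mcEstimator hx ha hh.le N).sub (memLp_const _)).integrable_sq, ?_, ?_⟩
  · intro ha' i
    rw [hT, hmse i, E₁_eq_bias_sq N ha'.ne hh, E₂_eq_riemannVariance N ha'.ne hh, hBc]
    field_simp
  · rintro rfl
    refine ⟨bias σ h N 0 ^ 2, N * riemannVariance σ h N 0, ?_, ?_, ?_, ?_, fun i => ?_⟩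
    · rw [bias_zero, hT]
      ring
    · rw [riemannVariance_zero, hT]
      field_simp
      ring
    · refine ((((continuous_bias σ h N).pow 2).tendsto 0).mono_left
        nhdsWithin_le_nhds).congr' ?_
      filter_upwards [self_mem_nhdsWithin] with b hb
      rw [hT, E₁_eq_bias_sq N hb hh, Pi.pow_apply]
    · refine (((continuous_const.mul (continuous_riemannVariance σ h N)).tendsto 0).mono_left
        nhdsWithin_le_nhds).congr' ?_
      filter_upwards [self_mem_nhdsWithin] with b hb
      exact (hT ▸ E₂_eq_riemannVariance N hb hh).symm
    · rw [hT, hmse i, hBc]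
      field_simp
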